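/- Let $X$ be an Archimedean (real) vector lattice and let $n\ge 0$ be an integer. A net $(x_\alpha)$ in $X$ converges uniformly to $x\in X$ if there is $e\in X$ with $e\ge 0$ such that for every $\varepsilon>0$ one has $|x_\alpha-x|\le\varepsilon e$ for all sufficiently large $\alpha$; a subset of $X$ is uniformly closed if it contains the limit of every uniformly convergent net of its elements. A sublattice of $X$ is a linear subspace closed under $\vee$ and $\wedge$, and a lattice homomorphism is a linear map preserving $\vee$ and $\wedge$; $\mathbb R^n$ carries the coordinatewise order. Then the uniformly closed sublattices of $X$ of codimension at most $n$ are exactly the kernels of differences of two lattice homomorphisms from $X$ to $\mathbb R^n$. That is, a linear subspace $Y\subseteq X$ is a uniformly closed sublattice with $\dim(X/Y)\le n$ if and only if there are lattice homomorphisms $S,T\colon X\to\mathbb R^n$ with $Y=\ker(S-T)$. -/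

import Mathlib

/-- The Archimedean property of an ordered vector space: the only elements `x` all of whose
natural multiples lie below a fixed `y` are those with `x ≤ 0`. (Mathlib's class `Archimedean`
demands instead that every `y > 0` be a strong order unit, which already fails in `ℝ × ℝ`.) -/
def VectorLattice.IsArchimedean (X : Type*) [AddCommGroup X] [Lattice X] : Prop :=
  ∀ x y : X, (∀ k : ℕ, k • x ≤ y) → x ≤ 0

namespace VectorLattice

section

variable {X : Type*} [AddCommGroup X] [Lattice X] [Module ℝ X]

/-- A family `f` converges relatively uniformly to `x` along the filter `l`: for some `e ≥ 0`,
the norm `‖f i - x‖ₑ = inf {c > 0 | |f i - x| ≤ c • e}` tends to `0` along `l`.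
Nets are the case where `l` is `atTop` on a nonempty directed set. -/
def UniformlyConverges {ι : Type*} (f : ι → X) (l : Filter ι) (x : X) : Prop :=
  ∃ e : X, 0 ≤ e ∧ ∀ ε : ℝ, 0 < ε → ∀ᶠ i in l, |f i - x| ≤ ε • e

/-- A set is uniformly closed if it is closed with respect to relative uniform convergence.
Proper filters on `X` containing `A` play the role of the nets in `A`. -/
def IsUniformlyClosed (A : Set X) : Prop :=
  ∀ (l : Filter X) (x : X), l.NeBot → A ∈ l → UniformlyConverges (fun y : X => y) l x → x ∈ A

/-- A (vector) sublattice is a linear subspace closed under the lattice operations. -/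
def IsVectorSublattice (Y : Submodule ℝ X) : Prop :=
  ∀ x ∈ Y, ∀ y ∈ Y, x ⊔ y ∈ Y ∧ x ⊓ y ∈ Y

/-- A lattice homomorphism between vector lattices is a linear map preserving `⊔` and `⊓`. -/
def IsLatticeHomomorphism {Z : Type*} [AddCommGroup Z] [Lattice Z] [Module ℝ Z]
    (T : X →ₗ[ℝ] Z) : Prop :=
  ∀ x y : X, T (x ⊔ y) = T x ⊔ T y ∧ T (x ⊓ y) = T x ⊓ T y

end

end VectorLattice

/-!
The kernel of a difference `S - T` of lattice homomorphisms into `ℝ^n` is a sublattice because `S`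
and `T` agree on it, it is uniformly closed because lattice homomorphisms are positive, and its
codimension is the dimension of the range of `S - T`.

Conversely, let `Y` be a uniformly closed sublattice of codimension at most `n`, and let `J` be
`solidInterior Y`, the largest ideal contained in `Y`; it is uniformly closed too. The heart of the
argument is that only boundedly many elements outside `J` can be pairwise disjoint modulo `J`
(`exists_mem_solidInterior_of_disjoint`). For elements `y i` of `Y` this is seen by choosing
`z i ∉ Y` with `|z i| ≤ |y i|`: too many of them satisfy a linear relation modulo `Y`, and
truncating that relation by a multiple of `|y i|`, an operation that preserves `Y`, isolates a
single `z i` and puts it into `Y`. The general case reduces to this one, since linear combinations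
of sufficiently many elements of `X` already meet `Y`.

For a largest family disjoint modulo `J`, the ideals of elements disjoint modulo `J` from one member
are prime and uniformly closed, and they intersect in `J`
(`exists_finset_isPrimeSubspace_disjointModulo`). The quotient by a proper such ideal is totally
ordered and one-dimensional, so the ideal is the kernel of a lattice homomorphism into `ℝ`
(`exists_isLatticeHomomorphism_ker_eq`). Hence `Y` contains the common kernel of finitely many
real-valued lattice homomorphisms, and a finite form of the Stone–Weierstrass theorem
(`exists_mem_forall_eq`) shows that `Y` is the common kernel of the functionals that vanish on it
and are differences of two lattice homomorphisms. These functionals span a space of dimension at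
most `n`, so `n` of them suffice (`exists_fin_forall_eq_zero`).
-/

namespace VectorLattice

open LatticeOrderedAddCommGroup

/-! ### Truncation to an order interval -/

section Group

variable {X : Type*} [AddCommGroup X] [Lattice X] [IsOrderedAddMonoid X]

/-- The truncation of `z` to the order interval `[-v, v]`. -/
def truncate (v z : X) : X := (z ⊔ -v) ⊓ v

/-- The Riesz decomposition property, in the form that truncation to `[-v, v]` splits off from `z`
a remainder bounded by `w`. -/
theorem abs_sub_truncate_le {v w z : X} (hw : 0 ≤ w) (hz : |z| ≤ v + w) :
    |z - truncate v z| ≤ w := by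
  have h1 : z ≤ v + w := (le_abs_self z).trans hz
  have h2 : -z ≤ v + w := (neg_le_abs z).trans hz
  refine abs_le'.2 ⟨?_, ?_⟩
  · rw [sub_le_comm]
    exact le_inf ((sub_le_self z hw).trans le_sup_left) (sub_le_iff_le_add.2 h1)
  · rw [neg_sub, sub_le_iff_le_add]
    refine inf_le_left.trans (sup_le (le_add_of_nonneg_left hw) ?_)
    rw [neg_le, neg_add, ← sub_eq_add_neg, sub_eq_add_neg, add_comm, ← sub_eq_add_neg]
    exact sub_le_iff_le_add.2 h2

theorem abs_truncate_sub_truncate_le (v x y : X) : |truncate v x - truncate v y| ≤ |x - y| :=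
  (abs_inf_sub_inf_le_abs _ _ _).trans (abs_sup_sub_sup_le_abs _ _ _)

theorem truncate_of_abs_le {v x : X} (h : |x| ≤ v) : truncate v x = x := by
  have h1 : -v ≤ x := neg_le.2 ((neg_le_abs x).trans h)
  rw [truncate, sup_eq_left.2 h1, inf_eq_left.2 ((le_abs_self x).trans h)]

theorem abs_truncate_le {v : X} (hv : 0 ≤ v) (x : X) : |truncate v x| ≤ v := by
  refine abs_le'.2 ⟨inf_le_right, ?_⟩
  rw [neg_le]
  exact le_inf le_sup_right ((neg_nonpos.2 hv).trans hv)

theorem abs_truncate_le_abs {v : X} (hv : 0 ≤ v) (x : X) : |truncate v x| ≤ |x| := by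
  have h := abs_truncate_sub_truncate_le v x 0
  rwa [truncate_of_abs_le (x := (0 : X)) (by simpa using hv), sub_zero, sub_zero] at h

/-- Truncation recovers `u` from `u + r` up to the part of `r` that meets the bound `v`. -/
theorem abs_truncate_add_sub_le {u v : X} (h : |u| ≤ v) (r : X) :
    |truncate v (u + r) - u| ≤ |r| ⊓ (v + v) := by
  have hv : 0 ≤ v := (abs_nonneg u).trans h
  refine le_inf ?_ ?_
  · have h' := abs_truncate_sub_truncate_le v (u + r) u
    rwa [truncate_of_abs_le h, add_sub_cancel_left] at h'
  · rw [sub_eq_add_neg]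
    refine (abs_add_le _ _).trans (add_le_add (abs_truncate_le hv _) ?_)
    rwa [abs_neg]

theorem add_inf_le_of_nonneg {a b c : X} (ha : 0 ≤ a) (hb : 0 ≤ b) (hc : 0 ≤ c) :
    (a + b) ⊓ c ≤ a ⊓ c + b ⊓ c := by
  rw [add_inf, inf_add, inf_add]
  exact le_inf (le_inf inf_le_left (inf_le_right.trans (le_add_of_nonneg_right hb)))
    (le_inf (inf_le_right.trans (le_add_of_nonneg_left ha))
      (inf_le_right.trans (le_add_of_nonneg_left hc)))

end Group

/-! ### Uniformly closed sets and solid subspaces -/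

section Ideals

variable {X : Type*} [AddCommGroup X] [Lattice X] [Module ℝ X]

theorem abs_mem_of_isVectorSublattice {Y : Submodule ℝ X} (hY : IsVectorSublattice Y) {x : X}
    (hx : x ∈ Y) : |x| ∈ Y :=
  (hY x hx (-x) (Y.neg_mem hx)).1

theorem truncate_mem_of_isVectorSublattice {Y : Submodule ℝ X} (hY : IsVectorSublattice Y)
    {v x : X} (hv : v ∈ Y) (hx : x ∈ Y) : truncate v x ∈ Y :=
  (hY _ (hY x hx (-v) (Y.neg_mem hv)).1 v hv).2

variable [IsOrderedAddMonoid X]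

theorem abs_mem_iff_of_isSolid {J : Submodule ℝ X} (hJ : IsSolid (J : Set X)) {x : X} :
    |x| ∈ J ↔ x ∈ J :=
  ⟨fun h => hJ h (abs_abs x).ge, fun h => hJ h (abs_abs x).le⟩

theorem mem_of_nonneg_of_le_of_isSolid {J : Submodule ℝ X} (hJ : IsSolid (J : Set X)) {x y : X}
    (hy : y ∈ J) (hx : 0 ≤ x) (hxy : x ≤ y) : x ∈ J :=
  hJ hy (by rwa [abs_of_nonneg hx, abs_of_nonneg (hx.trans hxy)])

variable [IsOrderedModule ℝ X]

theorem abs_real_smul (c : ℝ) (x : X) : |c • x| = |c| • |x| := by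
  have key : ∀ c : ℝ, 0 ≤ c → |c • x| = c • |x| := fun c hc => by
    rcases hc.eq_or_lt with rfl | hc
    · simp
    · rw [abs, abs, ← smul_neg]
      exact ((OrderIso.smulRight hc).map_sup x (-x)).symm
  rcases le_total 0 c with hc | hc
  · rw [key c hc, abs_of_nonneg hc]
  · rw [abs_of_nonpos hc, ← key _ (neg_nonneg.2 hc), neg_smul, abs_neg]

/-- Uniform closedness in terms of approximation by single elements instead of filters. -/
theorem isUniformlyClosed_iff {A : Set X} :
    IsUniformlyClosed A ↔
      ∀ x e : X, 0 ≤ e → (∀ ε : ℝ, 0 < ε → ∃ a ∈ A, |a - x| ≤ ε • e) → x ∈ A := by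
  constructor
  · intro hA x e he h
    choose a haA ha using fun k : ℕ => h (1 / ((k : ℝ) + 1)) Nat.one_div_pos_of_nat
    refine hA (Filter.map a Filter.atTop) x inferInstance
      (Filter.mem_map.2 (Filter.univ_mem' haA)) ⟨e, he, fun ε hε => ?_⟩
    obtain ⟨N, hN⟩ := exists_nat_one_div_lt hε
    filter_upwards [Filter.image_mem_map (Filter.mem_atTop N)] with y hy
    obtain ⟨k, hk, rfl⟩ := hy
    exact (ha k).trans (smul_le_smul_of_nonneg_right
      ((Nat.one_div_le_one_div hk).trans hN.le) he)
  · rintro h l x hl hAl ⟨e, he, hconv⟩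
    refine h x e he fun ε hε => ?_
    obtain ⟨a, haA, ha⟩ := (Filter.inter_mem hAl (hconv ε hε) |> Filter.nonempty_of_mem)
    exact ⟨a, haA, ha⟩

/-- The largest ideal (solid subspace) contained in a subspace `Y`. -/
def solidInterior (Y : Submodule ℝ X) : Submodule ℝ X where
  carrier := {x | ∀ z, |z| ≤ |x| → z ∈ Y}
  zero_mem' z hz := by
    rw [abs_zero] at hz
    have : |z| = 0 := le_antisymm hz (abs_nonneg z)
    have h1 : z = 0 := le_antisymm ((le_abs_self z).trans hz)
      (neg_nonpos.1 ((neg_le_abs z).trans hz))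
    exact h1 ▸ Y.zero_mem
  add_mem' {x y} hx hy z hz := by
    have h1 := hx (truncate |x| z) (abs_truncate_le (abs_nonneg x) z)
    have h2 := hy (z - truncate |x| z) (abs_sub_truncate_le (abs_nonneg y)
      (hz.trans (abs_add_le x y)))
    simpa using Y.add_mem h1 h2
  smul_mem' c x hx z hz := by
    rcases eq_or_ne c 0 with rfl | hc
    · refine hx z (hz.trans ?_)
      simp
    · have h := hx (c⁻¹ • z) (by
        rw [abs_real_smul] at hz ⊢
        rw [abs_inv]
        exact (inv_smul_le_iff_of_pos (abs_pos.2 hc)).2 hz)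
      simpa [smul_smul, hc] using Y.smul_mem c h

theorem solidInterior_le (Y : Submodule ℝ X) :
    solidInterior Y ≤ Y :=
  fun x hx => hx x le_rfl

theorem isSolid_solidInterior (Y : Submodule ℝ X) :
    IsSolid (solidInterior Y : Set X) :=
  fun _ hx _ hyx z hz => hx z (hz.trans hyx)

theorem isUniformlyClosed_solidInterior {Y : Submodule ℝ X}
    (hc : IsUniformlyClosed (Y : Set X)) :
    IsUniformlyClosed (solidInterior Y : Set X) := by
  rw [isUniformlyClosed_iff] at hc ⊢
  intro x e he h z hz
  -- Truncations of `z` by elements of the ideal near `x` lie in `Y` and approximate `z`.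
  refine hc z e he fun ε hε => ?_
  obtain ⟨a, ha, hax⟩ := h ε hε
  refine ⟨truncate |a| z, ha _ (abs_truncate_le (abs_nonneg a) z), ?_⟩
  rw [abs_sub_comm]
  refine (abs_sub_truncate_le (abs_nonneg (a - x)) (hz.trans ?_)).trans hax
  rw [abs_sub_comm]
  simpa using abs_add_le a (x - a)

/-- The elements disjoint from `v` modulo an ideal `J`. -/
def disjointModulo (J : Submodule ℝ X) (hJ : IsSolid (J : Set X)) (v : X) : Submodule ℝ X where
  carrier := {r | |r| ⊓ |v| ∈ J}
  zero_mem' := by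
    change |0| ⊓ |v| ∈ J
    rw [abs_zero, inf_eq_left.2 (abs_nonneg v)]
    exact J.zero_mem
  add_mem' {r s} hr hs := by
    refine mem_of_nonneg_of_le_of_isSolid hJ (J.add_mem hr hs)
      (le_inf (abs_nonneg _) (abs_nonneg _)) ?_
    exact (inf_le_inf_right _ (abs_add_le r s)).trans
      (add_inf_le_of_nonneg (abs_nonneg _) (abs_nonneg _) (abs_nonneg _))
  smul_mem' c r hr := by
    have hk : (0 : ℝ) < |c| + 1 := by positivity
    refine mem_of_nonneg_of_le_of_isSolid hJ (J.smul_mem (|c| + 1) hr)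
      (le_inf (abs_nonneg _) (abs_nonneg _)) ?_
    rw [(show (|c| + 1) • (|r| ⊓ |v|) = ((|c| + 1) • |r|) ⊓ ((|c| + 1) • |v|) from
      (OrderIso.smulRight hk).map_inf _ _), abs_real_smul]
    refine inf_le_inf (smul_le_smul_of_nonneg_right (by linarith) (abs_nonneg r)) ?_
    have := smul_le_smul_of_nonneg_right (show (1 : ℝ) ≤ |c| + 1 by linarith [abs_nonneg c])
      (abs_nonneg v)
    rwa [one_smul] at this

variable {J : Submodule ℝ X} {hJ : IsSolid (J : Set X)}

theorem mem_disjointModulo {v r : X} : r ∈ disjointModulo J hJ v ↔ |r| ⊓ |v| ∈ J := Iff.rfl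

theorem mem_disjointModulo_comm {v r : X} :
    r ∈ disjointModulo J hJ v ↔ v ∈ disjointModulo J hJ r := by
  rw [mem_disjointModulo, mem_disjointModulo, inf_comm]

theorem mem_disjointModulo_self {v : X} : v ∈ disjointModulo J hJ v ↔ v ∈ J := by
  rw [mem_disjointModulo, inf_idem, abs_mem_iff_of_isSolid hJ]

theorem isSolid_disjointModulo (v : X) : IsSolid (disjointModulo J hJ v : Set X) :=
  fun _ hx _ hyx => mem_of_nonneg_of_le_of_isSolid hJ hx
    (le_inf (abs_nonneg _) (abs_nonneg _)) (inf_le_inf_right _ hyx)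

theorem isUniformlyClosed_disjointModulo (hc : IsUniformlyClosed (J : Set X)) (v : X) :
    IsUniformlyClosed (disjointModulo J hJ v : Set X) := by
  rw [isUniformlyClosed_iff] at hc ⊢
  intro x e he h
  refine hc _ e he fun ε hε => ?_
  obtain ⟨a, ha, hax⟩ := h ε hε
  exact ⟨_, ha, (abs_inf_sub_inf_le_abs _ _ _).trans ((abs_abs_sub_abs_le a x).trans hax)⟩

/-- If `r` is disjoint from `v` modulo `J`, then truncation to `[-v, v]` recovers `u` from `u + r`
modulo `J`, for every `u` bounded by `v`. -/
theorem truncate_add_sub_mem {u v r : X} (huv : |u| ≤ v) (hr : r ∈ disjointModulo J hJ v) :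
    truncate v (u + r) - u ∈ J := by
  have hv : 0 ≤ v := (abs_nonneg u).trans huv
  have h : |r| ⊓ |v + v| ∈ J := mem_disjointModulo_comm.1
    ((disjointModulo J hJ r).add_mem (mem_disjointModulo_comm.1 hr)
      (mem_disjointModulo_comm.1 hr))
  rw [abs_of_nonneg (add_nonneg hv hv)] at h
  exact hJ h ((abs_truncate_add_sub_le huv r).trans (le_abs_self _))

end Ideals

/-! ### Families pairwise disjoint modulo an ideal -/

/-- A family longer than the codimension of `Y` has a nontrivial linear combination in `Y`. -/
theorem exists_sum_smul_mem {X : Type*} [AddCommGroup X] [Module ℝ X]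
    {Y : Submodule ℝ X} {n : ℕ}
    (hr : Module.rank ℝ (X ⧸ Y) ≤ (n : Cardinal)) (z : Fin (n + 1) → X) :
    ∃ c : Fin (n + 1) → ℝ, ∑ i, c i • z i ∈ Y ∧ ∃ i, c i ≠ 0 := by
  have : ¬ LinearIndependent ℝ (fun i => Y.mkQ (z i)) := fun h => by
    have h1 := h.cardinal_lift_le_rank.trans (Cardinal.lift_le.2 hr)
    simp only [Cardinal.mk_fin, Cardinal.lift_natCast, Nat.cast_le] at h1
    omega
  obtain ⟨c, hc, i, hi⟩ := Fintype.not_linearIndependent_iff.1 this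
  refine ⟨c, ?_, i, hi⟩
  rw [← Submodule.Quotient.mk_eq_zero, ← Submodule.mkQ_apply]
  simpa using hc

section Counting

variable {X : Type*} [AddCommGroup X] [Lattice X] [IsOrderedAddMonoid X] [Module ℝ X]
  [IsOrderedModule ℝ X]

/-- Any `n + 1` elements of a sublattice `Y` of codimension at most `n` that are pairwise disjoint
modulo the largest ideal `J ⊆ Y` include an element of `J`: otherwise below each of them some
element outside `Y` could be found, and a linear relation between these modulo `Y` would, after
truncation, put one of them into `Y`. -/
theorem exists_mem_solidInterior_of_disjoint_of_mem {Y : Submodule ℝ X}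
    (hY : IsVectorSublattice Y) {n : ℕ} (hr : Module.rank ℝ (X ⧸ Y) ≤ (n : Cardinal))
    (y : Fin (n + 1) → X) (hy : ∀ i, y i ∈ Y)
    (hdisj : Pairwise fun i j => |y i| ⊓ |y j| ∈ solidInterior Y) :
    ∃ i, y i ∈ solidInterior Y := by
  by_contra! hnot
  have hz : ∀ i, ∃ z, |z| ≤ |y i| ∧ z ∉ Y := fun i => by
    by_contra! h
    exact hnot i h
  choose z hzy hzY using hz
  obtain ⟨c, hc, i, hi⟩ := exists_sum_smul_mem hr z
  have hJ := isSolid_solidInterior Y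
  have hv : |c i| • |y i| ∈ Y := Y.smul_mem _ (abs_mem_of_isVectorSublattice hY (hy i))
  have hu : c i • z i ∈ Y := by
    rw [Fintype.sum_eq_add_sum_compl i] at hc
    have htr := truncate_mem_of_isVectorSublattice hY hv hc
    refine (Y.sub_mem_iff_right htr).1
      (solidInterior_le Y (truncate_add_sub_mem (hJ := hJ) ?_ ?_))
    · rw [abs_real_smul]
      exact smul_le_smul_of_nonneg_left (hzy i) (abs_nonneg _)
    · refine Submodule.sum_mem _ fun j hj => Submodule.smul_mem _ _ ?_
      refine isSolid_disjointModulo _ (x := y j) ?_ (hzy j)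
      refine mem_disjointModulo_comm.1 (Submodule.smul_mem _ _ ?_)
      have hij : i ≠ j := fun h => by simp [h] at hj
      exact isSolid_disjointModulo (hJ := hJ) (y j) (x := y i) (hdisj hij) (abs_abs _).le
  exact hzY i ((Y.smul_mem_iff hi).1 hu)

/-- A combination `∑ i, c i • x i` of elements pairwise disjoint modulo an ideal `J` lies in `J`
only if each of its terms does. -/
theorem smul_mem_of_sum_smul_mem_of_disjoint {J : Submodule ℝ X} (hJ : IsSolid (J : Set X))
    {ι : Type*} [Fintype ι] {x : ι → X} (hdisj : Pairwise fun i j => |x i| ⊓ |x j| ∈ J)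
    {c : ι → ℝ} (hc : ∑ i, c i • x i ∈ J) (i : ι) : c i • x i ∈ J := by
  classical
  rw [Fintype.sum_eq_add_sum_compl i] at hc
  have hr : ∑ j ∈ ({i}ᶜ : Finset ι), c j • x j ∈ disjointModulo J hJ (|c i • x i|) := by
    refine Submodule.sum_mem _ fun j hj => Submodule.smul_mem _ _ ?_
    refine mem_disjointModulo_comm.1 (isSolid_disjointModulo _ (x := c i • x i)
      (Submodule.smul_mem _ _ ?_) (abs_abs _).le)
    exact hdisj fun h => by simp [h] at hj
  set r := ∑ j ∈ ({i}ᶜ : Finset ι), c j • x j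
  set u := c i • x i
  have h1 : truncate |u| (u + r) - u ∈ J := truncate_add_sub_mem le_rfl hr
  have h2 : truncate |u| (u + r) ∈ J := hJ hc (abs_truncate_le_abs (abs_nonneg u) _)
  simpa using J.sub_mem h2 h1

/-- Among `(n + 1) ^ 2` elements pairwise disjoint modulo the largest ideal `J` in a sublattice of
codimension at most `n`, one lies in `J`: relations within blocks of `n + 1` elements produce
`n + 1` elements of the sublattice that are pairwise disjoint modulo `J`. -/
theorem exists_mem_solidInterior_of_disjoint {Y : Submodule ℝ X}
    (hY : IsVectorSublattice Y) {n : ℕ} (hr : Module.rank ℝ (X ⧸ Y) ≤ (n : Cardinal))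
    (x : Fin (n + 1) × Fin (n + 1) → X)
    (hdisj : Pairwise fun i j => |x i| ⊓ |x j| ∈ solidInterior Y) :
    ∃ i, x i ∈ solidInterior Y := by
  have hJ := isSolid_solidInterior Y
  choose c hcY hc using fun a => exists_sum_smul_mem hr fun b => x (a, b)
  obtain ⟨a, ha⟩ := exists_mem_solidInterior_of_disjoint_of_mem hY hr _ hcY fun a a' haa' => by
    change _ ∈ disjointModulo _ hJ _
    refine Submodule.sum_mem _ fun b _ => Submodule.smul_mem _ _ (mem_disjointModulo_comm.1 ?_)
    refine Submodule.sum_mem _ fun b' _ => Submodule.smul_mem _ _ ?_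
    exact hdisj fun h => haa' (congrArg Prod.fst h).symm
  obtain ⟨b, hb⟩ := hc a
  have hab := smul_mem_of_sum_smul_mem_of_disjoint hJ
    (fun b b' hbb' => hdisj fun h => hbb' (congrArg Prod.snd h)) ha b
  exact ⟨(a, b), (Submodule.smul_mem_iff _ hb).1 hab⟩

end Counting

/-! ### Prime ideals from a maximal disjoint family -/

section Prime

variable {X : Type*} [AddCommGroup X] [Lattice X] [Module ℝ X]

/-- A subspace is prime if `|u| ⊓ |v|` lies in it only when `u` or `v` does. For an ideal this says
that the quotient is totally ordered. Properness is not required. -/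
def IsPrimeSubspace (P : Submodule ℝ X) : Prop :=
  ∀ u v : X, |u| ⊓ |v| ∈ P → u ∈ P ∨ v ∈ P

variable [IsOrderedAddMonoid X] [IsOrderedModule ℝ X]

/-- If the families avoiding an ideal `J` and pairwise disjoint modulo `J` are bounded in size, then
`J` is cut out by the ideals `disjointModulo J hJ v`, `v` running through a largest such family, and
all of these are prime. -/
theorem exists_finset_isPrimeSubspace_disjointModulo {J : Submodule ℝ X}
    (hJ : IsSolid (J : Set X)) {N : ℕ}
    (hN : ∀ F : Finset X, (∀ v ∈ F, v ∉ J) →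
      (∀ v ∈ F, ∀ w ∈ F, v ≠ w → |v| ⊓ |w| ∈ J) → F.card ≤ N) :
    ∃ F : Finset X, (∀ v ∈ F, v ∉ J) ∧ (∀ v ∈ F, IsPrimeSubspace (disjointModulo J hJ v)) ∧
      ∀ z, (∀ v ∈ F, z ∈ disjointModulo J hJ v) → z ∈ J := by
  classical
  let good : Finset X → Prop := fun F => (∀ v ∈ F, v ∉ J) ∧
      (∀ v ∈ F, ∀ w ∈ F, v ≠ w → |v| ⊓ |w| ∈ J)
  obtain ⟨F, hF, hmax⟩ : ∃ F, good F ∧ ∀ G, good G → G.card ≤ F.card := by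
    let S : Set ℕ := {k | ∃ F, good F ∧ F.card = k}
    have hne : S.Nonempty := ⟨0, ∅, by simp [good]⟩
    have hbdd : BddAbove S := ⟨N, by rintro _ ⟨F, hF, rfl⟩; exact hN F hF.1 hF.2⟩
    obtain ⟨F, hF, hk⟩ := Nat.sSup_mem hne hbdd
    exact ⟨F, hF, fun G hG => hk ▸ le_csSup hbdd ⟨G, hG, rfl⟩⟩
  -- An element outside `J` that is disjoint modulo `J` from a good family enlarges it.
  have hins : ∀ G z, good G → z ∉ J → (∀ v ∈ G, z ∈ disjointModulo J hJ v) →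
      good (insert z G) ∧ (insert z G).card = G.card + 1 := by
    intro G z hG hz hzG
    refine ⟨⟨?_, ?_⟩, Finset.card_insert_of_notMem fun h =>
      hz (mem_disjointModulo_self.1 (hzG z h))⟩
    · intro v hv
      rcases Finset.mem_insert.1 hv with rfl | hv
      exacts [hz, hG.1 v hv]
    · intro v hv w hw hvw
      rcases Finset.mem_insert.1 hv with rfl | hv' <;>
        rcases Finset.mem_insert.1 hw with rfl | hw'
      · exact absurd rfl hvw
      · exact hzG w hw'
      · exact mem_disjointModulo_comm.1 (hzG v hv')
      · exact hG.2 v hv' w hw' hvw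
  refine ⟨F, hF.1, fun x hx u w huw => ?_, fun z hz => ?_⟩
  · -- Otherwise `x` could be replaced by the two elements `|u| ⊓ |x|` and `|w| ⊓ |x|`.
    by_contra! hcon
    have hG : good (F.erase x) := ⟨fun v hv => hF.1 v (Finset.mem_of_mem_erase hv),
      fun v hv w hw => hF.2 v (Finset.mem_of_mem_erase hv) w (Finset.mem_of_mem_erase hw)⟩
    have habs : ∀ s : X, |(|s| ⊓ |x|)| = |s| ⊓ |x| := fun s =>
      abs_of_nonneg (le_inf (abs_nonneg _) (abs_nonneg _))
    have hbelow : ∀ s : X, ∀ v ∈ F.erase x, |s| ⊓ |x| ∈ disjointModulo J hJ v := fun s v hv =>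
      isSolid_disjointModulo v (x := x)
        (hF.2 x hx v (Finset.mem_of_mem_erase hv) (Finset.ne_of_mem_erase hv).symm)
        (by rw [habs]; exact inf_le_right)
    obtain ⟨hG1, hcard1⟩ := hins _ _ hG hcon.1 (hbelow u)
    obtain ⟨hG2, hcard2⟩ := hins _ (|w| ⊓ |x|) hG1 hcon.2 fun v hv => by
      rcases Finset.mem_insert.1 hv with rfl | hv
      · rw [mem_disjointModulo, habs, habs, ← inf_inf_distrib_right, inf_comm |w|]
        rw [mem_disjointModulo, abs_of_nonneg (le_inf (abs_nonneg _) (abs_nonneg _))] at huw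
        exact huw
      · exact hbelow w v hv
    have := hmax _ hG2
    have := Finset.card_erase_add_one hx
    omega
  · by_contra hzJ
    obtain ⟨hG, hcard⟩ := hins F z hF hzJ hz
    have := hmax _ hG
    omega

end Prime

/-! ### Lattice homomorphisms into `ℝ` from prime ideals -/

theorem abs_posPart_sub_posPart_le {X : Type*} [AddCommGroup X] [Lattice X] [IsOrderedAddMonoid X]
    (x y : X) : |x⁺ - y⁺| ≤ |x - y| :=
  abs_sup_sub_sup_le_abs x y 0

theorem posPart_real_smul {X : Type*} [AddCommGroup X] [Lattice X] [Module ℝ X]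
    [IsOrderedModule ℝ X] {c : ℝ} (hc : 0 < c) (x : X) : (c • x)⁺ = c • x⁺ := by
  rw [posPart_def, posPart_def]
  have h : c • (x ⊔ 0) = c • x ⊔ c • 0 := (OrderIso.smulRight hc).map_sup x 0
  rw [h, smul_zero]

section Hom

variable {X : Type*} [AddCommGroup X] [Lattice X] [Module ℝ X]

theorem IsLatticeHomomorphism.map_abs {Z : Type*} [AddCommGroup Z] [Lattice Z] [Module ℝ Z]
    {h : X →ₗ[ℝ] Z} (hh : IsLatticeHomomorphism h) (x : X) : h |x| = |h x| := by
  rw [abs, abs, (hh _ _).1, map_neg]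

variable [IsOrderedAddMonoid X]

theorem isLatticeHomomorphism_of_map_abs {h : X →ₗ[ℝ] ℝ} (hh : ∀ x, h |x| = |h x|) :
    IsLatticeHomomorphism h := fun x y => by
  constructor
  · rw [sup_eq_half_smul_add_add_abs_sub' ℝ x y, sup_eq_half_smul_add_add_abs_sub' ℝ (h x)]
    simp only [map_smul, map_add, map_sub, hh]
  · rw [inf_eq_half_smul_add_sub_abs_sub' ℝ x y, inf_eq_half_smul_add_sub_abs_sub' ℝ (h x)]
    simp only [map_smul, map_add, map_sub, hh]

variable [IsOrderedModule ℝ X]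

theorem isClosed_setOf_mem_of_abs_sub_le {A : Set X} (hA : IsUniformlyClosed A) {e : X}
    (he : 0 ≤ e) {f : ℝ → X} (hf : ∀ s t, |f s - f t| ≤ |s - t| • e) :
    IsClosed {t | f t ∈ A} := by
  rw [isUniformlyClosed_iff] at hA
  refine isClosed_of_closure_subset fun t ht => hA _ e he fun ε hε => ?_
  obtain ⟨s, hs, hst⟩ := Metric.mem_closure_iff.1 ht ε hε
  refine ⟨f s, hs, (hf s t).trans (smul_le_smul_of_nonneg_right ?_ he)⟩
  rw [← Real.dist_eq, dist_comm]
  exact hst.le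

variable {P : Submodule ℝ X}

/-- If `e ≥ 0` lies outside a uniformly closed subspace `P`, then for some `t` the positive part of
`t • e - x` lies outside `P`. -/
theorem exists_posPart_smul_sub_notMem (hc : IsUniformlyClosed (P : Set X)) {e : X} (he : 0 ≤ e)
    (heP : e ∉ P) (x : X) : ∃ t : ℝ, (t • e - x)⁺ ∉ P := by
  by_contra! h
  -- Dividing by `t → ∞` would exhibit `e` as a uniform limit of elements of `P`.
  refine heP (isUniformlyClosed_iff.1 hc e |x| (abs_nonneg x) fun ε hε => ?_)
  refine ⟨ε • (ε⁻¹ • e - x)⁺, P.smul_mem _ (h _), ?_⟩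
  rw [← posPart_real_smul hε, smul_sub, smul_smul, mul_inv_cancel₀ hε.ne', one_smul]
  have := abs_posPart_sub_posPart_le (e - ε • x) e
  rw [posPart_of_nonneg he] at this
  refine this.trans ?_
  rw [sub_sub_cancel_left, abs_neg, abs_real_smul, abs_of_pos hε]

/-- A quotient by a uniformly closed prime ideal has dimension at most one. -/
theorem exists_sub_smul_mem (hc : IsUniformlyClosed (P : Set X))
    (hP : IsPrimeSubspace P) {e : X} (he : 0 ≤ e) (heP : e ∉ P) (x : X) :
    ∃ t : ℝ, x - t • e ∈ P := by
  -- The real line is the union of two closed sets: modulo `P`, those `t` with `t • e ≤ x` and those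
  -- with `x ≤ t • e`. By connectedness they meet.
  have hlip : ∀ s t : ℝ, |(s • e - x)⁺ - (t • e - x)⁺| ≤ |s - t| • e := fun s t => by
    refine (abs_posPart_sub_posPart_le _ _).trans ?_
    rw [sub_sub_sub_cancel_right, ← sub_smul, abs_real_smul, abs_of_nonneg he]
  have hlip' : ∀ s t : ℝ, |(x - s • e)⁺ - (x - t • e)⁺| ≤ |s - t| • e := fun s t => by
    refine (abs_posPart_sub_posPart_le _ _).trans ?_
    rw [sub_sub_sub_cancel_left, ← sub_smul, abs_real_smul, abs_of_nonneg he, abs_sub_comm]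
  have hcover : ∀ t : ℝ, (t • e - x)⁺ ∈ P ∨ (x - t • e)⁺ ∈ P := fun t => by
    refine hP _ _ ?_
    rw [abs_of_nonneg (posPart_nonneg _), abs_of_nonneg (posPart_nonneg _),
      ← neg_sub (t • e) x, posPart_neg, posPart_inf_negPart_eq_zero]
    exact P.zero_mem
  obtain ⟨s, hs⟩ := exists_posPart_smul_sub_notMem hc he heP x
  obtain ⟨s', hs'⟩ := exists_posPart_smul_sub_notMem hc he heP (-x)
  have hs'' : (x - (-s') • e)⁺ ∉ P := by
    rwa [neg_smul, sub_neg_eq_add, add_comm, ← sub_neg_eq_add]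
  obtain ⟨t, -, ht, ht'⟩ := isPreconnected_closed_iff.1 (isPreconnected_univ (α := ℝ)) _ _
    (isClosed_setOf_mem_of_abs_sub_le hc he hlip) (isClosed_setOf_mem_of_abs_sub_le hc he hlip')
    (fun t _ => hcover t) ⟨-s', trivial, (hcover _).resolve_right hs''⟩
    ⟨s, trivial, (hcover _).resolve_left hs⟩
  refine ⟨t, ?_⟩
  have h := P.sub_mem ht' ht
  rwa [← neg_sub x (t • e), posPart_neg, posPart_sub_negPart] at h

/-- A uniformly closed prime ideal is the kernel of a real-valued lattice homomorphism, namely the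
coordinate along an `e ≥ 0` outside it. -/
theorem exists_isLatticeHomomorphism_ker_eq (hc : IsUniformlyClosed (P : Set X))
    (hs : IsSolid (P : Set X)) (hP : IsPrimeSubspace P) {e : X} (heP : e ∉ P) :
    ∃ h : X →ₗ[ℝ] ℝ, IsLatticeHomomorphism h ∧ LinearMap.ker h = P := by
  wlog he : 0 ≤ e generalizing e
  · exact this (fun h => heP ((abs_mem_iff_of_isSolid hs).1 h)) (abs_nonneg e)
  choose t ht using exists_sub_smul_mem hc hP he heP
  have huniq : ∀ x (s : ℝ), x - s • e ∈ P → t x = s := fun x s hs' => by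
    by_contra hne
    have h := P.sub_mem hs' (ht x)
    rw [sub_sub_sub_cancel_left, ← sub_smul] at h
    exact heP ((P.smul_mem_iff (sub_ne_zero.2 hne)).1 h)
  refine ⟨{ toFun := t, map_add' := fun x y => huniq _ _ ?_, map_smul' := fun c x => huniq _ _ ?_ },
    isLatticeHomomorphism_of_map_abs fun x => huniq _ _ ?_, ?_⟩
  · have h := P.add_mem (ht x) (ht y)
    rwa [sub_add_sub_comm, ← add_smul] at h
  · have h := P.smul_mem c (ht x)
    rwa [smul_sub, smul_smul] at h
  · refine hs (ht x) ?_
    have h := abs_abs_sub_abs_le x (t x • e)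
    rwa [abs_real_smul, abs_of_nonneg he] at h
  · ext x
    rw [LinearMap.mem_ker]
    change t x = 0 ↔ _
    refine ⟨fun h => ?_, fun h => huniq _ _ (by simpa using h)⟩
    have := ht x
    rwa [h, zero_smul, sub_zero] at this

end Hom

/-- A uniformly closed sublattice of finite codimension contains the common kernel of finitely many
real-valued lattice homomorphisms. -/
theorem exists_finite_isLatticeHomomorphism {X : Type*} [AddCommGroup X] [Lattice X]
    [IsOrderedAddMonoid X] [Module ℝ X] [IsOrderedModule ℝ X] {Y : Submodule ℝ X}
    (hY : IsVectorSublattice Y) (hc : IsUniformlyClosed (Y : Set X)) {n : ℕ}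
    (hr : Module.rank ℝ (X ⧸ Y) ≤ (n : Cardinal)) :
    ∃ H : Set (X →ₗ[ℝ] ℝ), H.Finite ∧ (∀ h ∈ H, IsLatticeHomomorphism h) ∧
      ∀ x, (∀ h ∈ H, h x = 0) → x ∈ Y := by
  have hJ := isSolid_solidInterior Y
  obtain ⟨F, hF, hprime, hinter⟩ := exists_finset_isPrimeSubspace_disjointModulo hJ
    (N := (n + 1) * (n + 1)) fun F hF hdisj => by
      by_contra! hcard
      obtain ⟨f⟩ := Function.Embedding.nonempty_of_card_le
        (α := Fin (n + 1) × Fin (n + 1)) (β := F) (by simpa using hcard.le)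
      obtain ⟨i, hi⟩ := exists_mem_solidInterior_of_disjoint hY hr (fun i => (f i : X))
        fun i j hij => hdisj _ (f i).2 _ (f j).2 fun h => hij (f.injective (Subtype.ext h))
      exact hF _ (f i).2 hi
  have hcJ := isUniformlyClosed_solidInterior hc
  choose! h hh hker using fun (v : X) (hv : v ∈ F) =>
    exists_isLatticeHomomorphism_ker_eq (isUniformlyClosed_disjointModulo (hJ := hJ) hcJ v)
      (isSolid_disjointModulo v) (hprime v hv) fun hvv => hF v hv (mem_disjointModulo_self.1 hvv)
  refine ⟨h '' F, F.finite_toSet.image h, ?_, fun x hx => solidInterior_le Y (hinter x ?_)⟩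
  · rintro _ ⟨v, hv, rfl⟩
    exact hh v hv
  · intro v hv
    rw [← hker v hv]
    exact hx _ ⟨v, hv, rfl⟩

/-! ### Separation by differences of two lattice homomorphisms -/

section Separation

variable {X : Type*} [AddCommGroup X] [Lattice X] [Module ℝ X]

theorem isLatticeHomomorphism_zero {Z : Type*} [AddCommGroup Z] [Lattice Z] [Module ℝ Z] :
    IsLatticeHomomorphism (0 : X →ₗ[ℝ] Z) :=
  fun _ _ => by simp

theorem IsLatticeHomomorphism.smul {h : X →ₗ[ℝ] ℝ} (hh : IsLatticeHomomorphism h) {c : ℝ}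
    (hc : 0 ≤ c) : IsLatticeHomomorphism (c • h) := fun x y => by
  simp only [LinearMap.smul_apply, smul_eq_mul, (hh x y).1, (hh x y).2]
  exact ⟨mul_max_of_nonneg _ _ hc, mul_min_of_nonneg _ _ hc⟩

/-- The functionals vanishing on `Y` that are differences of two lattice homomorphisms. -/
def homDifferences (Y : Submodule ℝ X) : Set (Module.Dual ℝ X) :=
  {φ | (∃ S T : X →ₗ[ℝ] ℝ, IsLatticeHomomorphism S ∧ IsLatticeHomomorphism T ∧ φ = S - T) ∧
    ∀ y ∈ Y, φ y = 0}

theorem smul_sub_smul_mem_homDifferences {Y : Submodule ℝ X} {h k : X →ₗ[ℝ] ℝ}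
    (hh : IsLatticeHomomorphism h) (hk : IsLatticeHomomorphism k) {a b : ℝ} (ha : 0 ≤ a)
    (hb : 0 ≤ b) (hY : ∀ y ∈ Y, a * h y - b * k y = 0) : a • h - b • k ∈ homDifferences Y :=
  ⟨⟨_, _, hh.smul ha, hk.smul hb, rfl⟩, fun y hy => by simpa using hY y hy⟩

/-- If all of `homDifferences Y` vanishes at `x`, then any two lattice homomorphisms can be matched
at `x` by an element of `Y`. The values `(h y, k y)` form a sublattice of `ℝ × ℝ`; a linear
relation among them whose coefficients have the same strict sign forces this sublattice to be
zero, and every other relation is a difference of two lattice homomorphisms. -/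
theorem exists_mem_eq_eq {Y : Submodule ℝ X} (hY : IsVectorSublattice Y) {h k : X →ₗ[ℝ] ℝ}
    (hh : IsLatticeHomomorphism h) (hk : IsLatticeHomomorphism k) {x : X}
    (hx : ∀ φ ∈ homDifferences Y, φ x = 0) : ∃ y ∈ Y, h y = h x ∧ k y = k x := by
  by_contra! hcon
  obtain ⟨f, hfx, hf⟩ := Submodule.exists_le_ker_of_notMem (p := Y.map (h.prod k))
    (v := (h x, k x)) fun ⟨y, hy, hyx⟩ =>
      hcon y hy (congrArg Prod.fst hyx) (congrArg Prod.snd hyx)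
  set a := f (1, 0)
  set b := f (0, 1)
  have hfab : ∀ s t : ℝ, f (s, t) = a * s + b * t := fun s t => by
    have : ((s, t) : ℝ × ℝ) = s • (1, 0) + t • (0, 1) := by simp
    rw [this, map_add, map_smul, map_smul, smul_eq_mul, smul_eq_mul, mul_comm s, mul_comm t]
  rw [hfab] at hfx
  have hfY : ∀ y ∈ Y, a * h y + b * k y = 0 := fun y hy => by
    rw [← hfab]
    exact hf ⟨y, hy, rfl⟩
  have hrel : ∀ c d : ℝ, 0 ≤ c → 0 ≤ d → (∀ y ∈ Y, c * h y - d * k y = 0) →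
      c * h x - d * k x = 0 := fun c d hc hd hcd => by
    simpa using hx _ (smul_sub_smul_mem_homDifferences hh hk hc hd hcd)
  rcases le_or_gt (a * b) 0 with hab | hab
  · rcases mul_nonpos_iff.1 hab with ⟨ha, hb⟩ | ⟨ha, hb⟩
    · have := hrel a (-b) ha (neg_nonneg.2 hb) fun y hy => by linarith [hfY y hy]
      exact hfx (by linarith)
    · have := hrel (-a) b (neg_nonneg.2 ha) hb fun y hy => by linarith [hfY y hy]
      exact hfx (by linarith)
  · have hzero : ∀ y ∈ Y, h y = 0 ∧ k y = 0 := fun y hy => by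
      have h1 := hfY _ (hY y hy (-y) (Y.neg_mem hy)).1
      change a * h |y| + b * k |y| = 0 at h1
      rw [hh.map_abs, hk.map_abs] at h1
      have hsum : a ^ 2 * |h y| + a * b * |k y| = 0 := by linear_combination a * h1
      have ha : a ≠ 0 := left_ne_zero_of_mul hab.ne'
      have hp1 : 0 ≤ a ^ 2 * |h y| := by positivity
      have hp2 : 0 ≤ a * b * |k y| := mul_nonneg hab.le (abs_nonneg _)
      have e1 : a ^ 2 * |h y| = 0 := by linarith
      have e2 : a * b * |k y| = 0 := by linarith
      exact ⟨abs_eq_zero.1 ((mul_eq_zero.1 e1).resolve_left (pow_ne_zero 2 ha)),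
        abs_eq_zero.1 ((mul_eq_zero.1 e2).resolve_left hab.ne')⟩
    have hx1 := hrel 1 0 zero_le_one le_rfl fun y hy => by simp [hzero y hy]
    have hx2 := hrel 0 1 le_rfl zero_le_one fun y hy => by simp [hzero y hy]
    have hhx : h x = 0 := by linarith
    have hkx : k x = 0 := by linarith
    exact hfx (by rw [hhx, hkx]; ring)

/-- A finite form of the lattice version of the Stone–Weierstrass theorem: elements of `Y` that
match `x` at pairs of lattice homomorphisms combine, by infima and then suprema, to one that
matches `x` at all of finitely many lattice homomorphisms. -/
theorem exists_mem_forall_eq {Y : Submodule ℝ X} (hY : IsVectorSublattice Y)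
    {H : Set (X →ₗ[ℝ] ℝ)} (hfin : H.Finite) (hH : ∀ h ∈ H, IsLatticeHomomorphism h) {x : X}
    (hx : ∀ φ ∈ homDifferences Y, φ x = 0) : ∃ y ∈ Y, ∀ h ∈ H, h y = h x := by
  have hinf : ∀ h ∈ H, ∃ y ∈ Y, h y = h x ∧ ∀ k ∈ H, k y ≤ k x := fun h hh => by
    suffices ∀ K ⊆ H, K.Finite → ∃ y ∈ Y, h y = h x ∧ ∀ k ∈ K, k y ≤ k x from
      this H subset_rfl hfin
    intro K hKH hK
    induction K, hK using Set.Finite.induction_on with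
    | empty =>
      obtain ⟨y, hy, hyx, -⟩ := exists_mem_eq_eq hY (hH h hh) (hH h hh) hx
      exact ⟨y, hy, hyx, by simp⟩
    | @insert k K _ _ ih =>
      obtain ⟨y, hy, hyx, hyK⟩ := ih ((Set.subset_insert k K).trans hKH)
      have hkH := hKH (Set.mem_insert k K)
      obtain ⟨z, hz, hzx, hzk⟩ := exists_mem_eq_eq hY (hH h hh) (hH k hkH) hx
      refine ⟨y ⊓ z, (hY y hy z hz).2, by rw [(hH h hh y z).2, hyx, hzx, inf_idem], ?_⟩
      rintro l (rfl | hl)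
      · rw [(hH _ hkH y z).2, ← hzk]
        exact inf_le_right
      · rw [(hH l (hKH (Set.mem_insert_of_mem k hl)) y z).2]
        exact inf_le_left.trans (hyK l hl)
  suffices ∀ K ⊆ H, K.Finite → ∃ y ∈ Y, (∀ k ∈ K, k x ≤ k y) ∧ ∀ k ∈ H, k y ≤ k x by
    obtain ⟨y, hy, h1, h2⟩ := this H subset_rfl hfin
    exact ⟨y, hy, fun h hh => le_antisymm (h2 h hh) (h1 h hh)⟩
  intro K hKH hK
  induction K, hK using Set.Finite.induction_on with
  | empty =>
    rcases H.eq_empty_or_nonempty with rfl | ⟨h, hh⟩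
    · exact ⟨0, Y.zero_mem, by simp, by simp⟩
    · obtain ⟨y, hy, -, hyH⟩ := hinf h hh
      exact ⟨y, hy, by simp, hyH⟩
  | @insert k K _ _ ih =>
    obtain ⟨y, hy, hyK, hyH⟩ := ih ((Set.subset_insert k K).trans hKH)
    have hkH := hKH (Set.mem_insert k K)
    obtain ⟨z, hz, hzk, hzH⟩ := hinf k hkH
    refine ⟨y ⊔ z, (hY y hy z hz).1, ?_, fun l hl => ?_⟩
    · rintro l (rfl | hl)
      · rw [(hH _ hkH y z).1, ← hzk]
        exact le_sup_right
      · rw [(hH l (hKH (Set.mem_insert_of_mem k hl)) y z).1]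
        exact (hyK l hl).trans le_sup_left
    · rw [(hH l hl y z).1]
      exact sup_le (hyH l hl) (hzH l hl)

end Separation

/-- Linearly independent functionals vanishing on a subspace of codimension at most `n` number at
most `n`, so a spanning subset of a set of such functionals can be listed in `n` places. -/
theorem exists_fin_forall_eq_zero {K V : Type*} [Field K] [AddCommGroup V] [Module K V]
    {Y : Submodule K V} {n : ℕ} (hr : Module.rank K (V ⧸ Y) ≤ (n : Cardinal))
    {R : Set (Module.Dual K V)} (hR : ∀ φ ∈ R, ∀ y ∈ Y, φ y = 0) (h0 : 0 ∈ R) :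
    ∃ f : Fin n → Module.Dual K V, (∀ i, f i ∈ R) ∧
      ∀ x, (∀ i, f i x = 0) → ∀ φ ∈ R, φ x = 0 := by
  have : FiniteDimensional K (V ⧸ Y) :=
    Module.rank_lt_aleph0_iff.1 (hr.trans_lt Cardinal.natCast_lt_aleph0)
  have hfin : Module.finrank K (V ⧸ Y) ≤ n := Module.finrank_le_of_rank_le hr
  have e := Y.dualQuotEquivDualAnnihilator
  have : FiniteDimensional K Y.dualAnnihilator := e.finiteDimensional
  have hfin' : Module.finrank K Y.dualAnnihilator ≤ n := by
    rw [← e.finrank_eq, Subspace.dual_finrank_eq]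
    exact hfin
  obtain ⟨B, hBR, hspan, hB⟩ := exists_linearIndependent K R
  let g : B → Y.dualAnnihilator := fun φ =>
    ⟨φ, (Submodule.mem_dualAnnihilator _).2 (hR φ (hBR φ.2))⟩
  have hg : LinearIndependent K g := LinearIndependent.of_comp Y.dualAnnihilator.subtype hB
  have : Finite B := hg.finite
  have := Fintype.ofFinite B
  have hcard : Fintype.card B ≤ Fintype.card (Fin n) := by
    rw [Fintype.card_fin]
    exact hg.fintype_card_le_finrank.trans hfin'
  obtain ⟨j⟩ := Function.Embedding.nonempty_of_card_le hcard
  refine ⟨Function.extend j (fun φ => (φ : Module.Dual K V)) 0, fun i => ?_, fun x hx φ hφ => ?_⟩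
  · by_cases hi : ∃ φ, j φ = i
    · obtain ⟨φ, rfl⟩ := hi
      rw [j.injective.extend_apply]
      exact hBR φ.2
    · rw [Function.extend_apply' _ _ _ hi]
      exact h0
  · have hle : Submodule.span K B ≤ LinearMap.ker (Module.Dual.eval K V x) :=
      Submodule.span_le.2 fun ψ hψ => by
        have := hx (j ⟨ψ, hψ⟩)
        rw [j.injective.extend_apply] at this
        exact this
    exact hle (hspan ▸ Submodule.subset_span hφ)

/-! ### Kernels of differences of two lattice homomorphisms -/

section Kernel

variable {X Z : Type*} [AddCommGroup X] [Lattice X] [Module ℝ X]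
  [AddCommGroup Z] [Lattice Z] [Module ℝ Z]

theorem isVectorSublattice_ker_sub {S T : X →ₗ[ℝ] Z} (hS : IsLatticeHomomorphism S)
    (hT : IsLatticeHomomorphism T) : IsVectorSublattice (LinearMap.ker (S - T)) := by
  intro x hx y hy
  rw [LinearMap.mem_ker, LinearMap.sub_apply, sub_eq_zero] at hx hy
  simp only [LinearMap.mem_ker, LinearMap.sub_apply, sub_eq_zero]
  rw [(hS x y).1, (hT x y).1, (hS x y).2, (hT x y).2, hx, hy]
  exact ⟨rfl, rfl⟩

theorem IsLatticeHomomorphism.monotone {T : X →ₗ[ℝ] Z} (hT : IsLatticeHomomorphism T) :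
    Monotone T := fun x y hxy => by
  rw [← sup_eq_right, ← (hT x y).1, sup_eq_right.2 hxy]

/-- Lattice homomorphisms `S` and `T` into `ℝ^n` satisfy
`|(S - T) x| ≤ |S (a - x)| + |T (a - x)| ≤ ε • (S e + T e)` whenever `(S - T) a = 0` and
`|a - x| ≤ ε • e`. -/
theorem isUniformlyClosed_ker_sub [IsOrderedAddMonoid X] [IsOrderedModule ℝ X] {ι : Type*}
    {S T : X →ₗ[ℝ] (ι → ℝ)} (hS : IsLatticeHomomorphism S) (hT : IsLatticeHomomorphism T) :
    IsUniformlyClosed (LinearMap.ker (S - T) : Set X) := by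
  rw [isUniformlyClosed_iff]
  intro x e he h
  rw [SetLike.mem_coe, LinearMap.mem_ker]
  funext i
  have hnonneg : ∀ {U : X →ₗ[ℝ] (ι → ℝ)}, IsLatticeHomomorphism U → 0 ≤ U e i := fun hU => by
    simpa using hU.monotone he i
  have hbound : ∀ {U : X →ₗ[ℝ] (ι → ℝ)}, IsLatticeHomomorphism U → ∀ {a : X} {ε : ℝ},
      |a - x| ≤ ε • e → |U a i - U x i| ≤ ε * U e i := fun {U} hU {a ε} ha => by
    have := hU.monotone ha i
    rw [hU.map_abs, map_sub, map_smul] at this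
    exact this
  refine abs_nonpos_iff.1 (le_of_forall_pos_le_add fun δ hδ => ?_)
  have hC : 0 < S e i + T e i + 1 := by linarith [hnonneg hS, hnonneg hT]
  obtain ⟨a, ha, hax⟩ := h (δ / (S e i + T e i + 1)) (div_pos hδ hC)
  have h1 := hbound hS hax
  have h2 := hbound hT hax
  have h3 : S a i - T a i = 0 := congrFun (LinearMap.mem_ker.1 ha) i
  have h4 : δ / (S e i + T e i + 1) * (S e i + T e i) ≤ δ := by
    rw [div_mul_eq_mul_div, div_le_iff₀ hC]
    exact mul_le_mul_of_nonneg_left (by linarith) hδ.le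
  rw [LinearMap.sub_apply, Pi.sub_apply, zero_add]
  rw [abs_le] at h1 h2 ⊢
  constructor <;> linarith

end Kernel

end VectorLattice

theorem mainTheorem10 {X : Type*} [AddCommGroup X] [Lattice X] [IsOrderedAddMonoid X]
    [Module ℝ X] [IsOrderedModule ℝ X] (hX : VectorLattice.IsArchimedean X)
    (n : ℕ) (Y : Submodule ℝ X) :
    (VectorLattice.IsVectorSublattice Y ∧ VectorLattice.IsUniformlyClosed (Y : Set X) ∧
        Module.rank ℝ (X ⧸ Y) ≤ (n : Cardinal)) ↔
      ∃ S T : X →ₗ[ℝ] (Fin n → ℝ),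
        VectorLattice.IsLatticeHomomorphism S ∧ VectorLattice.IsLatticeHomomorphism T ∧
          Y = LinearMap.ker (S - T) := by
  constructor
  · rintro ⟨hY, hc, hr⟩
    obtain ⟨H, hfin, hH, hker⟩ := VectorLattice.exists_finite_isLatticeHomomorphism hY hc hr
    obtain ⟨f, hf, hfx⟩ := VectorLattice.exists_fin_forall_eq_zero hr
      (R := VectorLattice.homDifferences Y) (fun φ hφ => hφ.2)
      ⟨⟨0, 0, VectorLattice.isLatticeHomomorphism_zero, VectorLattice.isLatticeHomomorphism_zero,
        (sub_zero 0).symm⟩, fun _ _ => rfl⟩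
    choose S T hS hT hST using fun i => (hf i).1
    refine ⟨LinearMap.pi S, LinearMap.pi T, fun x y => ⟨funext fun i => (hS i x y).1,
      funext fun i => (hS i x y).2⟩, fun x y => ⟨funext fun i => (hT i x y).1,
      funext fun i => (hT i x y).2⟩, ?_⟩
    have hpi : ∀ x i, (LinearMap.pi S - LinearMap.pi T) x i = f i x := fun x i => by
      rw [hST i]
      rfl
    ext x
    rw [LinearMap.mem_ker]
    refine ⟨fun hx => funext fun i => (hpi x i).trans ((hf i).2 x hx), fun hx => ?_⟩
    obtain ⟨y, hy, hyx⟩ := VectorLattice.exists_mem_forall_eq hY hfin hH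
      (hfx x fun i => by rw [← hpi, hx]; rfl)
    have hxy : x - y ∈ Y := hker _ fun h hh => by rw [map_sub, hyx h hh, sub_self]
    simpa using Y.add_mem hxy hy
  · rintro ⟨S, T, hS, hT, rfl⟩
    refine ⟨VectorLattice.isVectorSublattice_ker_sub hS hT,
      VectorLattice.isUniformlyClosed_ker_sub hS hT, ?_⟩
    have hinj : Function.Injective ((LinearMap.ker (S - T)).liftQ (S - T) le_rfl) :=
      LinearMap.ker_eq_bot.1 (Submodule.ker_liftQ_eq_bot' _ _ rfl)
    have := LinearMap.lift_rank_le_of_injective _ hinj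
    simpa using this
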